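/- Let $K:\mathbb{R}^2\to\mathbb{R}$ be continuously differentiable on $\mathbb{R}^2\setminus\{0\}$ and weakly singular at the origin, i.e. there are $\alpha<2$ and $D>0$ such that $|K(\mathbf r)|\le D|\mathbf r|^{-\alpha}$ for all $\mathbf r\neq 0$ in a neighbourhood of $0$. Let $S\subset\mathbb{R}^2$ be a bounded closed region with piecewise smooth boundary, i.e. $S$ is compact and $\partial S$ is the union of finitely many regular $C^1$ arcs that meet only at their end points, oriented so that $S$ lies on their left and the complement of $S$ on their right, with positively oriented unit tangent vector $\boldsymbol\tau$ and arclength element $ds$. Let $\rho:S\to\mathbb{R}$ be continuously differentiable on $S$. Then for every point $\mathbf r_*\in S$ such that $S$ is star-shaped with respect to $\mathbf r_*$, all the integrals below converge absolutely and $$\int_{S} K(\mathbf r-\mathbf r_*)\,\rho(\mathbf r)\,dA=\oint_{\partial S}\left(\int_0^1 t\,K\bigl(t(\mathbf r-\mathbf r_*)\bigr)\,\rho\bigl(\mathbf r_*+t(\mathbf r-\mathbf r_*)\bigr)\,dt\right)\bigl((\mathbf r-\mathbf r_*)\times\boldsymbol\tau\bigr)\,ds,$$ where $\mathbf u\times\mathbf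 v=u_1v_2-u_2v_1$. -/

import Mathlib

open Set Filter Topology MeasureTheory

/-- The Euclidean plane. -/
abbrev Plane : Type := EuclideanSpace ℝ (Fin 2)

/-- The scalar cross product `u × v = u₁ v₂ - u₂ v₁` of plane vectors. -/
def cross (u v : Plane) : ℝ := u 0 * v 1 - u 1 * v 0

/-- Rotation of a plane vector by a quarter turn counterclockwise. -/
noncomputable def quarterTurn (v : Plane) : Plane := !₂[-(v 1), v 0]

/-- `K` is weakly singular at the origin: `|K r| ≤ D |r|^(-α)` for some `α < 2` and `D > 0`,
for all `r ≠ 0` in some neighbourhood of the origin. -/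
def IsWeaklySingular (K : Plane → ℝ) : Prop :=
  ∃ α : ℝ, α < 2 ∧ ∃ D : ℝ, 0 < D ∧ ∀ᶠ r in 𝓝[≠] (0 : Plane), |K r| ≤ D * ‖r‖ ^ (-α)

/-- A piecewise smooth, positively oriented parametrization of the boundary of a plane set `S`:
finitely many regular `C¹` arcs, each parametrized by `[0, 1]`, which cover the boundary of `S`,
meet only at their end points (an arc may be closed), and have `S` on their left and the
complement of `S` on their right. -/
structure PiecewiseSmoothBoundary (S : Set Plane) where
  /-- The number of arcs. -/
  n : ℕ
  /-- The arcs; only their values on `[0, 1]` matter. -/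
  arc : Fin n → ℝ → Plane
  contDiffOn_arc : ∀ i, ContDiffOn ℝ 1 (arc i) (Icc 0 1)
  deriv_ne_zero : ∀ i, ∀ t ∈ Icc (0 : ℝ) 1, derivWithin (arc i) (Icc 0 1) t ≠ 0
  /-- An arc does not pass twice through a point other than its end points,
  and different arcs meet only at end points of both of them. -/
  simple : ∀ i j, ∀ s ∈ Ioo (0 : ℝ) 1, ∀ t ∈ Icc (0 : ℝ) 1, arc i s = arc j t → i = j ∧ s = t
  iUnion_arc : ⋃ i, arc i '' Icc 0 1 = frontier S
  left_mem : ∀ i, ∀ t ∈ Ioo (0 : ℝ) 1, ∀ᶠ ε in 𝓝[>] (0 : ℝ),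
    arc i t + ε • quarterTurn (derivWithin (arc i) (Icc 0 1) t) ∈ S
  right_notMem : ∀ i, ∀ t ∈ Ioo (0 : ℝ) 1, ∀ᶠ ε in 𝓝[>] (0 : ℝ),
    arc i t - ε • quarterTurn (derivWithin (arc i) (Icc 0 1) t) ∉ S

namespace PiecewiseSmoothBoundary

variable {S : Set Plane} (B : PiecewiseSmoothBoundary S)

/-- The velocity of the `i`-th arc (one-sided at the end points). -/
noncomputable def velocity (i : Fin B.n) (t : ℝ) : Plane := derivWithin (B.arc i) (Icc 0 1) t

/-- The unit tangent vector `τ` of the `i`-th arc. -/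
noncomputable def unitTangent (i : Fin B.n) (t : ℝ) : Plane :=
  ‖B.velocity i t‖⁻¹ • B.velocity i t

/-- The integrand of `∮ g(r, τ) ds` along the `i`-th arc, with arclength element
`ds = |γ'(t)| dt`. -/
noncomputable def integrand (g : Plane → Plane → ℝ) (i : Fin B.n) (t : ℝ) : ℝ :=
  g (B.arc i t) (B.unitTangent i t) * ‖B.velocity i t‖

/-- The boundary integral `∮ g(r, τ) ds` converges absolutely. -/
def BoundaryIntegrable (g : Plane → Plane → ℝ) : Prop :=
  ∀ i, IntervalIntegrable (B.integrand g i) volume 0 1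

/-- The boundary integral `∮ g(r, τ) ds`, with respect to arclength, of a function of the
boundary point `r` and the positively oriented unit tangent vector `τ` at `r`. -/
noncomputable def boundaryIntegral (g : Plane → Plane → ℝ) : ℝ :=
  ∑ i, ∫ t in (0 : ℝ)..1, B.integrand g i t

end PiecewiseSmoothBoundary

/-! In cone coordinates `r = r₀ + s • (γ t - r₀)` with `s ∈ (0, 1)` the area element is `s |(γ - r₀)
× γ'| ds dt`, so over the cone spanned by an arc Fubini turns the area integral into the radial
integral integrated against `(γ - r₀) × τ ds`. It remains to see that the cones tile `S` with the
right sign.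

Near an interior point of an arc, directions transversal to the tangent miss the boundary, so the
side conditions extend from the normal to every transversal direction (`eventually_mem_and_notMem`).
With star-shapedness this gives `(γ - r₀) × γ' ≥ 0` (`cross_velocity_nonneg`), and where the
inequality is strict the ray leaves `S` for good (`add_smul_notMem`). Hence the cones over the
strictly transversal parts are injectively parametrized and disjoint, and they fill `S` up to a null
set (`iUnion_coneMap_image_ae_eq`), the rest being images of null or critical parameter sets.

For convergence, `|K ρ| ≤ C |r - r₀| ^ (-β)` with `1 ≤ β < 2`. The Jacobian supplies one power of
`s` and of `|γ - r₀|`, leaving `s ^ (1 - β) |γ - r₀| ^ (1 - β)`, which is integrable even if the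
regular arc `γ` passes through `r₀`. -/

open Asymptotics

/-! ### Cross product and chords of regular curves. -/

/-- The cross product as a continuous linear functional of its second argument. -/
noncomputable def crossCLM (u : Plane) : Plane →L[ℝ] ℝ :=
  u 0 • EuclideanSpace.proj 1 - u 1 • EuclideanSpace.proj 0

theorem crossCLM_apply (u v : Plane) : crossCLM u v = cross u v := by
  simp [crossCLM, cross]

theorem cross_self_eq_zero (u : Plane) : cross u u = 0 := by simp [cross, mul_comm]

theorem cross_neg_right (u v : Plane) : cross u (-v) = -cross u v := by
  simp [cross]; ring

theorem cross_swap (u v : Plane) : cross u v = -cross v u := by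
  simp [cross]; ring

theorem cross_smul_right (u v : Plane) (c : ℝ) : cross u (c • v) = c * cross u v := by
  simp [cross]; ring

theorem cross_quarterTurn_pos {v : Plane} (hv : v ≠ 0) : 0 < cross v (quarterTurn v) := by
  have h : cross v (quarterTurn v) = ‖v‖ ^ 2 := by
    rw [EuclideanSpace.norm_sq_eq]
    simp [cross, quarterTurn, Fin.sum_univ_two]; ring
  rw [h]; positivity

theorem abs_cross_le (u v : Plane) : |cross u v| ≤ ‖u‖ * ‖v‖ := by
  refine abs_le_of_sq_le_sq ?_ (by positivity)
  rw [mul_pow, EuclideanSpace.norm_sq_eq, EuclideanSpace.norm_sq_eq]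
  simp only [Fin.sum_univ_two, Real.norm_eq_abs, sq_abs, cross]
  nlinarith [sq_nonneg (u 0 * v 0 + u 1 * v 1)]

theorem continuous_cross : Continuous fun p : Plane × Plane => cross p.1 p.2 := by
  unfold cross; fun_prop

/-- Nonzero speed bounds chords below by parameter differences. This turns `o(s - t)` into `o` of
the chord, and later controls an arc passing through `r₀`. -/
theorem HasDerivWithinAt.isBigO_sub_chord {γ : ℝ → Plane} {v : Plane} {I : Set ℝ} {t : ℝ}
    (h : HasDerivWithinAt γ v I t) (hv : v ≠ 0) :
    (fun s => s - t) =O[𝓝[I] t] fun s => γ s - γ t :=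
  (h.isTheta_sub hv).isBigO_symm.comp_tendsto
    (tendsto_id.prodMk (tendsto_pure.2 (Eventually.of_forall fun _ => rfl)))

/-- Near a point of a `C¹` curve, the chords are nearly parallel to the tangent. -/
theorem HasDerivWithinAt.eventually_abs_cross_le {γ : ℝ → Plane} {v : Plane} {I : Set ℝ} {t : ℝ}
    (h : HasDerivWithinAt γ v I t) (hv : v ≠ 0) {η : ℝ} (hη : 0 < η) :
    ∀ᶠ s in 𝓝[I] t, |cross v (γ s - γ t)| ≤ η * ‖γ s - γ t‖ := by
  have h1 : (fun s => crossCLM v (γ s - γ t)) =o[𝓝[I] t] fun s => s - t := by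
    have h0 := (crossCLM v).hasFDerivAt.comp_hasDerivWithinAt t h
    rw [crossCLM_apply, cross_self_eq_zero] at h0
    simpa using hasDerivWithinAt_iff_isLittleO.1 h0
  filter_upwards [(h1.trans_isBigO (h.isBigO_sub_chord hv)).def hη] with s hs
  rwa [crossCLM_apply] at hs

/-! ### Local geometry and orientation of the boundary. -/

namespace PiecewiseSmoothBoundary

variable {S : Set Plane} (B : PiecewiseSmoothBoundary S)

theorem hasDerivWithinAt_arc (i : Fin B.n) {t : ℝ} (ht : t ∈ Icc (0 : ℝ) 1) :
    HasDerivWithinAt (B.arc i) (B.velocity i t) (Icc 0 1) t :=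
  ((B.contDiffOn_arc i).differentiableOn one_ne_zero t ht).hasDerivWithinAt

theorem continuousOn_arc (i : Fin B.n) : ContinuousOn (B.arc i) (Icc 0 1) :=
  (B.contDiffOn_arc i).continuousOn

theorem continuousOn_velocity (i : Fin B.n) : ContinuousOn (B.velocity i) (Icc 0 1) :=
  (B.contDiffOn_arc i).continuousOn_derivWithin (uniqueDiffOn_Icc zero_lt_one) le_rfl

theorem arc_mem_frontier (i : Fin B.n) {t : ℝ} (ht : t ∈ Icc (0 : ℝ) 1) :
    B.arc i t ∈ frontier S := by
  rw [← B.iUnion_arc]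
  exact mem_iUnion_of_mem i (mem_image_of_mem _ ht)

/-- Close to an interior point of an arc, directions transversal to the arc avoid the boundary. -/
theorem eventually_forall_notMem_frontier (i : Fin B.n) {t : ℝ} (ht : t ∈ Ioo (0 : ℝ) 1)
    {C : Set Plane} (hC : IsCompact C) (hCv : ∀ w ∈ C, cross (B.velocity i t) w ≠ 0) :
    ∀ᶠ ε in 𝓝[>] (0 : ℝ), ∀ w ∈ C, B.arc i t + ε • w ∉ frontier S := by
  -- Compactness of `[0, 1] × C` reduces the claim to a neighbourhood of each `(s₀, w₀)`. These
  -- neighbourhoods leave `[0, 1]`, where the arc is uncontrolled, hence the repeated membership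
  -- premise.
  have key : ∀ j, ∀ᶠ ε in 𝓝 (0 : ℝ), ∀ y ∈ Icc (0 : ℝ) 1 ×ˢ C,
      0 < ε → y.1 ∈ Icc (0 : ℝ) 1 → B.arc j y.1 - B.arc i t ≠ ε • y.2 := by
    intro j
    refine (isCompact_Icc.prod hC).eventually_forall_of_forall_eventually
      (P := fun ε y => 0 < ε → y.1 ∈ Icc (0 : ℝ) 1 → B.arc j y.1 - B.arc i t ≠ ε • y.2) ?_
    rintro ⟨s₀, w₀⟩ ⟨hs₀, hw₀⟩
    have hs : Tendsto (fun z : ℝ × ℝ × Plane => z.2.1) (𝓝 (0, s₀, w₀)) (𝓝 s₀) :=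
      (by fun_prop : Continuous fun z : ℝ × ℝ × Plane => z.2.1).tendsto _
    have hw : Tendsto (fun z : ℝ × ℝ × Plane => z.2.2) (𝓝 (0, s₀, w₀)) (𝓝 w₀) :=
      (by fun_prop : Continuous fun z : ℝ × ℝ × Plane => z.2.2).tendsto _
    have hεw : Tendsto (fun z : ℝ × ℝ × Plane => z.1 • z.2.2) (𝓝 (0, s₀, w₀)) (𝓝 0) := by
      simpa using (by fun_prop : Continuous fun z : ℝ × ℝ × Plane => z.1 • z.2.2).tendsto
        ((0 : ℝ), s₀, w₀)
    by_cases hp : B.arc j s₀ = B.arc i t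
    · obtain ⟨rfl, rfl⟩ := B.simple i j t ht s₀ hs₀ hp.symm
      set v := B.velocity i t
      have hc : 0 < |cross v w₀| := abs_pos.2 (hCv w₀ hw₀)
      -- Chosen so that `η ‖w‖ ≤ |v × w₀| / 2 < |v × w|` for `w` near `w₀`: such a `w` is too
      -- transversal to be parallel to a short chord.
      set η := |cross v w₀| / 2 / (‖w₀‖ + 1)
      have hη : 0 < η := by positivity
      have h1 := hs.eventually (eventually_nhdsWithin_iff.1
        ((B.hasDerivWithinAt_arc i hs₀).eventually_abs_cross_le (B.deriv_ne_zero i t hs₀) hη))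
      have h2 := hw.eventually ((continuous_norm.tendsto w₀).eventually_lt_const
        (lt_add_one ‖w₀‖))
      have h3 := hw.eventually (((crossCLM v).continuous.abs.tendsto w₀).eventually_const_lt
        (u := |cross v w₀| / 2) (by rw [crossCLM_apply]; linarith))
      filter_upwards [h1, h2, h3] with z h1 h2 h3 hε hz heq
      have h1 := h1 hz
      rw [heq, cross_smul_right, abs_mul, norm_smul, Real.norm_eq_abs, abs_of_pos hε] at h1
      rw [crossCLM_apply] at h3
      have h4 : |cross v z.2.2| ≤ η * ‖z.2.2‖ := by
        refine le_of_mul_le_mul_left ?_ hε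
        linarith
      have h5 : η * ‖z.2.2‖ ≤ |cross v w₀| / 2 := by
        calc η * ‖z.2.2‖ ≤ η * (‖w₀‖ + 1) := by gcongr
          _ = _ := div_mul_cancel₀ _ (by positivity)
      linarith
    -- Away from the base point the chord stays bounded below while `ε • w` tends to zero.
    · have h1 := hs.eventually (eventually_nhdsWithin_iff.1
        (((B.continuousOn_arc j s₀ hs₀).sub_const (B.arc i t)).norm.eventually_const_lt
          (u := ‖B.arc j s₀ - B.arc i t‖ / 2) (half_lt_self (norm_pos_iff.2 (sub_ne_zero.2 hp)))))
      have h2 := hεw.norm.eventually_lt_const (u := ‖B.arc j s₀ - B.arc i t‖ / 2)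
        (by simpa using sub_ne_zero.2 hp)
      filter_upwards [h1, h2] with z h1 h2 hε hz heq
      have := h1 hz
      rw [heq] at this
      linarith
  have key' := (eventually_all.2 key).filter_mono (nhdsWithin_le_nhds (s := Ioi 0))
  filter_upwards [key', self_mem_nhdsWithin] with ε h hε w hw hmem
  rw [← B.iUnion_arc] at hmem
  obtain ⟨j, s, hs, hj⟩ := mem_iUnion.1 hmem
  exact h j (s, w) ⟨hs, hw⟩ hε hs (by simp [hj])

/-- A connected segment missing the frontier cannot meet both the interior and the exterior. -/
theorem segment_mem_iff_of_notMem_frontier {p q : Plane}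
    (h : ∀ x ∈ segment ℝ p q, x ∉ frontier S) : p ∈ S ↔ q ∈ S := by
  have hsub : segment ℝ p q ⊆ interior S ∪ interior Sᶜ := by
    intro x hx
    rw [interior_compl]
    by_contra! hcon
    simp only [mem_union, mem_compl_iff, not_or, not_not] at hcon
    exact h x hx ⟨hcon.2, hcon.1⟩
  rcases (convex_segment (𝕜 := ℝ) p q).isPreconnected.subset_or_subset isOpen_interior
    isOpen_interior (disjoint_compl_right.mono interior_subset interior_subset) hsub with h | h
  · exact iff_of_true (interior_subset (h (left_mem_segment ℝ p q)))
      (interior_subset (h (right_mem_segment ℝ p q)))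
  · exact iff_of_false (interior_subset (h (left_mem_segment ℝ p q)))
      (interior_subset (h (right_mem_segment ℝ p q)))

/-- At an interior point of an arc, every direction to the left of the arc points into `S`
and the opposite direction points out of `S`. -/
theorem eventually_mem_and_notMem (i : Fin B.n) {t : ℝ} (ht : t ∈ Ioo (0 : ℝ) 1) {u : Plane}
    (hu : 0 < cross (B.velocity i t) u) :
    ∀ᶠ ε in 𝓝[>] (0 : ℝ), B.arc i t + ε • u ∈ S ∧ B.arc i t - ε • u ∉ S := by
  set v := B.velocity i t with hv
  have hpos : ∀ w ∈ segment ℝ (quarterTurn v) u, 0 < cross v w := by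
    rintro w ⟨a, b, ha, hb, hab, rfl⟩
    have h1 := cross_quarterTurn_pos (B.deriv_ne_zero i t (Ioo_subset_Icc_self ht))
    change 0 < cross v (quarterTurn v) at h1
    rw [← crossCLM_apply, map_add, map_smul, map_smul, crossCLM_apply, crossCLM_apply]
    rcases ha.eq_or_lt with rfl | ha
    · obtain rfl : b = 1 := by linarith
      simpa using hu
    · simp only [smul_eq_mul]; positivity
  have hcomp : IsCompact (segment ℝ (quarterTurn v) u) := by
    rw [← convexHull_pair]
    exact (toFinite _).isCompact_convexHull ℝ
  have h1 := B.eventually_forall_notMem_frontier i ht hcomp fun w hw => (hpos w hw).ne'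
  have h2 := B.eventually_forall_notMem_frontier i ht hcomp.neg fun w hw => by
    have := hpos _ hw
    rw [cross_neg_right] at this
    change cross v w ≠ 0
    linarith
  filter_upwards [h1, h2, B.left_mem i t ht, B.right_notMem i t ht] with ε h1 h2 h3 h4
  constructor
  · refine (segment_mem_iff_of_notMem_frontier ?_).1 h3
    rintro x ⟨a, b, ha, hb, hab, rfl⟩
    convert h1 _ ⟨a, b, ha, hb, hab, rfl⟩ using 2
    obtain rfl : b = 1 - a := by linarith
    change a • (B.arc i t + ε • quarterTurn v) + (1 - a) • (B.arc i t + ε • u) = _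
    module
  · refine fun h => h4 ((segment_mem_iff_of_notMem_frontier ?_).2 h)
    rintro x ⟨a, b, ha, hb, hab, rfl⟩
    convert h2 _ (neg_mem_neg.2 ⟨a, b, ha, hb, hab, rfl⟩) using 2
    obtain rfl : b = 1 - a := by linarith
    change a • (B.arc i t - ε • quarterTurn v) + (1 - a) • (B.arc i t - ε • u) = _
    module

/-- The boundary of a star-shaped set runs counterclockwise around the centre. -/
theorem cross_velocity_nonneg (hS : IsClosed S) {r₀ : Plane} (hstar : StarConvex ℝ r₀ S)
    (i : Fin B.n) {t : ℝ} (ht : t ∈ Ioo (0 : ℝ) 1) :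
    0 ≤ cross (B.arc i t - r₀) (B.velocity i t) := by
  by_contra! h
  -- Otherwise the outward ray direction points to the left, so stepping back towards `r₀` leaves
  -- `S`, against star-shapedness.
  rw [cross_swap, neg_lt_zero] at h
  have h01 : ∀ᶠ ε in 𝓝[>] (0 : ℝ), ε < 1 :=
    (eventually_lt_nhds zero_lt_one).filter_mono nhdsWithin_le_nhds
  obtain ⟨ε, ⟨⟨-, h1⟩, h2⟩, h3⟩ :=
    ((B.eventually_mem_and_notMem i ht h).and h01).and self_mem_nhdsWithin |>.exists
  have hmem := hS.frontier_subset (B.arc_mem_frontier i (Ioo_subset_Icc_self ht))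
  refine h1 ?_
  convert hstar hmem (a := ε) (b := 1 - ε) (le_of_lt h3) (by linarith) (by ring) using 1
  module

/-- Where the boundary of a star-shaped set is transversal to the ray from the centre,
the ray leaves the set for good. -/
theorem add_smul_notMem {r₀ : Plane} (hstar : StarConvex ℝ r₀ S)
    (i : Fin B.n) {t : ℝ} (ht : t ∈ Ioo (0 : ℝ) 1)
    (hpos : 0 < cross (B.arc i t - r₀) (B.velocity i t)) {c : ℝ} (hc : 1 < c) :
    c • (B.arc i t - r₀) + r₀ ∉ S := by
  intro hmem
  -- Here the direction towards `r₀` points to the left, so points just beyond the arc are outside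
  -- `S`. They would lie on the segment from `r₀` to the supposed point of `S`.
  rw [cross_swap, ← cross_neg_right] at hpos
  have h01 : ∀ᶠ ε in 𝓝[>] (0 : ℝ), ε < c - 1 :=
    (eventually_lt_nhds (by linarith)).filter_mono nhdsWithin_le_nhds
  obtain ⟨ε, ⟨⟨-, h1⟩, h2⟩, h3⟩ :=
    ((B.eventually_mem_and_notMem i ht hpos).and h01).and self_mem_nhdsWithin |>.exists
  refine h1 ?_
  have h3 : 0 < ε := h3
  have hle : (1 + ε) / c ≤ 1 := by rw [div_le_one (by linarith)]; linarith
  convert hstar hmem (a := 1 - (1 + ε) / c) (b := (1 + ε) / c) (by linarith) (by positivity)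
    (by ring) using 1
  rw [smul_add, smul_smul, div_mul_cancel₀ _ (by linarith)]
  module

end PiecewiseSmoothBoundary

/-! ### Cone coordinates and change of variables. -/

/-- Cartesian coordinates on the plane. -/
noncomputable def planeCoord : Plane ≃ᵐ ℝ × ℝ :=
  (MeasurableEquiv.toLp 2 (Fin 2 → ℝ)).symm.trans MeasurableEquiv.finTwoArrow

theorem measurePreserving_planeCoord : MeasurePreserving planeCoord :=
  (volume_preserving_finTwoArrow ℝ).comp
    (EuclideanSpace.volume_preserving_symm_measurableEquiv_toLp (Fin 2))

/-- The cone with apex `r₀` over the curve `γ`, as a map of the parameters `(t, s)`. -/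
noncomputable def coneMap (r₀ : Plane) (γ : ℝ → Plane) (p : ℝ × ℝ) : Plane :=
  p.2 • (γ p.1 - r₀) + r₀

/-- The derivative of `coneMap` in Cartesian coordinates. -/
noncomputable def coneDeriv (x v : Plane) (s : ℝ) : ℝ × ℝ →L[ℝ] ℝ × ℝ :=
  (Matrix.toLin (.finTwoProd ℝ) (.finTwoProd ℝ)
    !![s * v 0, x 0; s * v 1, x 1]).toContinuousLinearMap

theorem det_coneDeriv (x v : Plane) (s : ℝ) : (coneDeriv x v s).det = -(s * cross x v) := by
  unfold coneDeriv cross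
  simp only [LinearMap.det_toContinuousLinearMap, LinearMap.det_toLin, Matrix.det_fin_two_of]
  ring

theorem hasFDerivWithinAt_coneMap {r₀ : Plane} {γ : ℝ → Plane} {v : Plane} {I : Set ℝ}
    {A : Set (ℝ × ℝ)} {p : ℝ × ℝ} (h : HasDerivWithinAt γ v I p.1) (hA : A ⊆ I ×ˢ univ) :
    HasFDerivWithinAt (planeCoord ∘ coneMap r₀ γ) (coneDeriv (γ p.1 - r₀) v p.2) A p := by
  have hmaps : MapsTo Prod.fst A I := fun q hq => (hA hq).1
  have hcoord : ∀ k : Fin 2, HasFDerivWithinAt (fun q : ℝ × ℝ => q.2 * (γ q.1 k - r₀ k) + r₀ k)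
      (p.2 • (v k • ContinuousLinearMap.fst ℝ ℝ ℝ) +
        (γ p.1 k - r₀ k) • ContinuousLinearMap.snd ℝ ℝ ℝ) A p := by
    intro k
    have hk : HasDerivWithinAt (fun t => γ t k) (v k) I p.1 :=
      (EuclideanSpace.proj (𝕜 := ℝ) k).hasFDerivAt.comp_hasDerivWithinAt p.1 h
    exact (hasFDerivWithinAt_snd.mul
      ((hk.comp_hasFDerivWithinAt p hasFDerivWithinAt_fst hmaps).sub_const (r₀ k))).add_const _
  unfold coneDeriv
  rw [Matrix.toLin_finTwoProd_toContinuousLinearMap]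
  convert! (hcoord 0).prodMk (hcoord 1) using 2 <;> simp [smul_smul]

theorem volume_image_planeCoord (X : Set Plane) : volume (planeCoord '' X) = volume X := by
  rw [MeasurableEquiv.image_eq_preimage_symm]
  exact measurePreserving_planeCoord.symm.measure_preimage_equiv X

section

variable {r₀ : Plane} {γ v : ℝ → Plane} {I : Set ℝ} {A : Set (ℝ × ℝ)}

theorem volume_coneMap_image_of_null (h : ∀ t ∈ I, HasDerivWithinAt γ (v t) I t)
    (hA : A ⊆ I ×ˢ univ) (hA0 : volume A = 0) : volume (coneMap r₀ γ '' A) = 0 := by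
  rw [← volume_image_planeCoord, ← image_comp]
  exact addHaar_image_eq_zero_of_differentiableOn_of_addHaar_eq_zero volume
    (fun p hp => (hasFDerivWithinAt_coneMap (h p.1 (hA hp).1) hA).differentiableWithinAt) hA0

/-- The easy case of Sard's theorem: the Jacobian vanishes on `A`. -/
theorem volume_coneMap_image_of_cross_eq_zero (h : ∀ t ∈ I, HasDerivWithinAt γ (v t) I t)
    (hA : A ⊆ I ×ˢ univ) (hA0 : ∀ p ∈ A, cross (γ p.1 - r₀) (v p.1) = 0) :
    volume (coneMap r₀ γ '' A) = 0 := by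
  rw [← volume_image_planeCoord, ← image_comp]
  exact addHaar_image_eq_zero_of_det_fderivWithin_eq_zero volume
    (fun p hp => hasFDerivWithinAt_coneMap (h p.1 (hA hp).1) hA)
    (fun p hp => by rw [det_coneDeriv, hA0 p hp]; simp)

theorem measurableSet_coneMap_image (h : ∀ t ∈ I, HasDerivWithinAt γ (v t) I t)
    (hA : A ⊆ I ×ˢ univ) (hAm : MeasurableSet A) (hinj : InjOn (coneMap r₀ γ) A) :
    MeasurableSet (coneMap r₀ γ '' A) := by
  rw [← planeCoord.measurableEmbedding.measurableSet_image, ← image_comp]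
  exact measurable_image_of_fderivWithin hAm
    (fun p hp => hasFDerivWithinAt_coneMap (h p.1 (hA hp).1) hA)
    (planeCoord.injective.comp_injOn hinj)

theorem integrableOn_coneMap_image_iff (h : ∀ t ∈ I, HasDerivWithinAt γ (v t) I t)
    (hA : A ⊆ I ×ˢ univ) (hAm : MeasurableSet A) (hinj : InjOn (coneMap r₀ γ) A)
    (g : Plane → ℝ) :
    IntegrableOn g (coneMap r₀ γ '' A) ↔
      IntegrableOn (fun p => |p.2 * cross (γ p.1 - r₀) (v p.1)| * g (coneMap r₀ γ p)) A := by
  have := measurePreserving_planeCoord.integrableOn_image planeCoord.measurableEmbedding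
    (f := g ∘ planeCoord.symm) (s := coneMap r₀ γ '' A)
  rw [← image_comp, integrableOn_image_iff_integrableOn_abs_det_fderiv_smul volume hAm
    (fun p hp => hasFDerivWithinAt_coneMap (h p.1 (hA hp).1) hA)
    (planeCoord.injective.comp_injOn hinj)] at this
  simpa [Function.comp_def, det_coneDeriv] using this.symm

theorem setIntegral_coneMap_image (h : ∀ t ∈ I, HasDerivWithinAt γ (v t) I t)
    (hA : A ⊆ I ×ˢ univ) (hAm : MeasurableSet A) (hinj : InjOn (coneMap r₀ γ) A)
    (g : Plane → ℝ) :
    ∫ r in coneMap r₀ γ '' A, g r =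
      ∫ p in A, |p.2 * cross (γ p.1 - r₀) (v p.1)| * g (coneMap r₀ γ p) := by
  have := measurePreserving_planeCoord.setIntegral_image_emb planeCoord.measurableEmbedding
    (g ∘ planeCoord.symm) (coneMap r₀ γ '' A)
  rw [← image_comp, integral_image_eq_integral_abs_det_fderiv_smul volume hAm
    (fun p hp => hasFDerivWithinAt_coneMap (h p.1 (hA hp).1) hA)
    (planeCoord.injective.comp_injOn hinj)] at this
  simpa [Function.comp_def, det_coneDeriv] using this.symm

end

/-! ### Tiling of the star-shaped set by cones. -/

namespace PiecewiseSmoothBoundary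

variable {S : Set Plane} (B : PiecewiseSmoothBoundary S)

/-- The interior times at which the `i`-th arc is transversal to the rays from `r₀`. -/
def transversalTimes (r₀ : Plane) (i : Fin B.n) : Set ℝ :=
  {t ∈ Ioo (0 : ℝ) 1 | 0 < cross (B.arc i t - r₀) (B.velocity i t)}

theorem continuousOn_cross_velocity (r₀ : Plane) (i : Fin B.n) :
    ContinuousOn (fun t => cross (B.arc i t - r₀) (B.velocity i t)) (Icc 0 1) :=
  continuous_cross.comp_continuousOn
    (((B.continuousOn_arc i).sub continuousOn_const).prodMk (B.continuousOn_velocity i))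

theorem measurableSet_transversalTimes (r₀ : Plane) (i : Fin B.n) :
    MeasurableSet (B.transversalTimes r₀ i) :=
  (((B.continuousOn_cross_velocity r₀ i).mono Ioo_subset_Icc_self).isOpen_inter_preimage
    isOpen_Ioo isOpen_Ioi).measurableSet

theorem transversalTimes_prod_subset (r₀ : Plane) (i : Fin B.n) :
    B.transversalTimes r₀ i ×ˢ Ioo (0 : ℝ) 1 ⊆ Icc (0 : ℝ) 1 ×ˢ univ :=
  prod_mono (fun _ ht => Ioo_subset_Icc_self ht.1) (subset_univ _)

/-- Two points of transversal arcs on the same ray from the centre coincide. -/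
theorem eq_of_coneMap_eq (hS : IsClosed S) {r₀ : Plane} (hstar : StarConvex ℝ r₀ S)
    {i j : Fin B.n} {p q : ℝ × ℝ} (hp : p ∈ B.transversalTimes r₀ i ×ˢ Ioo (0 : ℝ) 1)
    (hq : q ∈ B.transversalTimes r₀ j ×ˢ Ioo (0 : ℝ) 1)
    (h : coneMap r₀ (B.arc i) p = coneMap r₀ (B.arc j) q) : i = j ∧ p = q := by
  -- If `p.2 < q.2`, the boundary point of `p` is a dilation by `q.2 / p.2 > 1` of that of `q`,
  -- hence outside `S`.
  have key : ∀ {i j : Fin B.n} {p q : ℝ × ℝ}, p ∈ B.transversalTimes r₀ i ×ˢ Ioo (0 : ℝ) 1 →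
      q ∈ B.transversalTimes r₀ j ×ˢ Ioo (0 : ℝ) 1 →
      coneMap r₀ (B.arc i) p = coneMap r₀ (B.arc j) q → q.2 ≤ p.2 := by
    intro i j p q hp hq h
    by_contra! hlt
    have hp2 := hp.2.1
    refine B.add_smul_notMem hstar j hq.1.1 hq.1.2 ((one_lt_div hp2).2 hlt) ?_
    have hx : (q.2 / p.2) • (B.arc j q.1 - r₀) = B.arc i p.1 - r₀ := by
      have h' : p.2 • (B.arc i p.1 - r₀) = q.2 • (B.arc j q.1 - r₀) := add_right_cancel h
      rw [div_eq_inv_mul, mul_smul, ← h', inv_smul_smul₀ hp2.ne']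
    rw [hx, sub_add_cancel]
    exact hS.frontier_subset (B.arc_mem_frontier i (Ioo_subset_Icc_self hp.1.1))
  have h2 : p.2 = q.2 := le_antisymm (key hq hp h.symm) (key hp hq h)
  have h' : p.2 • (B.arc i p.1 - r₀) = q.2 • (B.arc j q.1 - r₀) := add_right_cancel h
  rw [h2] at h'
  obtain ⟨hij, h1⟩ := B.simple i j p.1 hp.1.1 q.1 (Ioo_subset_Icc_self hq.1.1)
    (sub_left_injective (smul_right_injective _ hq.2.1.ne' h'))
  exact ⟨hij, Prod.ext h1 h2⟩

theorem coneMap_mem (hS : IsClosed S) {r₀ : Plane} (hstar : StarConvex ℝ r₀ S)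
    (i : Fin B.n) {p : ℝ × ℝ} (hp : p ∈ Icc (0 : ℝ) 1 ×ˢ Icc (0 : ℝ) 1) :
    coneMap r₀ (B.arc i) p ∈ S := by
  have hmem := hS.frontier_subset (B.arc_mem_frontier i hp.1)
  convert hstar hmem (a := 1 - p.2) (b := p.2) (by linarith [hp.2.2]) hp.2.1 (by ring) using 1
  unfold coneMap
  module

/-- Every point of a compact star-shaped set other than the centre lies on a segment from the
centre to the boundary. -/
theorem exists_coneMap_eq (hS : IsCompact S) {r₀ r : Plane} (hr : r ∈ S) (hne : r ≠ r₀) :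
    ∃ i, ∃ p ∈ Icc (0 : ℝ) 1 ×ˢ Ioc (0 : ℝ) 1, coneMap r₀ (B.arc i) p = r := by
  -- The largest dilation factor keeping `r` in `S` reaches the frontier; its inverse is the cone
  -- parameter of `r`.
  let L : Set ℝ := {c | 1 ≤ c ∧ c • (r - r₀) + r₀ ∈ S}
  have hcont : Continuous fun c : ℝ => c • (r - r₀) + r₀ := by fun_prop
  have hLc : IsClosed L := isClosed_Ici.inter (hS.isClosed.preimage hcont)
  have h1 : (1 : ℝ) ∈ L := ⟨le_rfl, by simpa using hr⟩
  have hLb : BddAbove L := by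
    obtain ⟨M, hM⟩ := hS.isBounded.exists_norm_le
    refine ⟨(M + ‖r₀‖) / ‖r - r₀‖, fun c hc => ?_⟩
    rw [le_div_iff₀ (norm_pos_iff.2 (sub_ne_zero.2 hne))]
    calc c * ‖r - r₀‖ = ‖c • (r - r₀)‖ := by
          rw [norm_smul, Real.norm_eq_abs, abs_of_nonneg (zero_le_one.trans hc.1)]
      _ = ‖(c • (r - r₀) + r₀) - r₀‖ := by simp
      _ ≤ M + ‖r₀‖ := (norm_sub_le _ _).trans (by gcongr; exact hM _ hc.2)
  set c := sSup L
  have hcL : c ∈ L := hLc.csSup_mem ⟨1, h1⟩ hLb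
  have hc0 : 0 < c := zero_lt_one.trans_le hcL.1
  have hfr : c • (r - r₀) + r₀ ∈ frontier S := by
    refine ⟨subset_closure hcL.2, fun hint => ?_⟩
    have hev : ∀ᶠ d in 𝓝 c, d • (r - r₀) + r₀ ∈ S :=
      hcont.continuousAt.eventually (mem_interior_iff_mem_nhds.1 hint)
    obtain ⟨d, hd, hcd⟩ := ((hev.filter_mono nhdsWithin_le_nhds).and
      (self_mem_nhdsWithin (s := Ioi c))).exists
    exact (le_csSup hLb ⟨hcL.1.trans (le_of_lt hcd), hd⟩).not_gt hcd
  rw [← B.iUnion_arc] at hfr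
  obtain ⟨i, t, ht, hti⟩ := mem_iUnion.1 hfr
  refine ⟨i, (t, c⁻¹), ⟨ht, by positivity, inv_le_one_of_one_le₀ hcL.1⟩, ?_⟩
  simp [coneMap, hti, smul_smul, hc0.ne']

/-- Up to a null set, a compact star-shaped set is the union of the open cones over the
transversal parts of its boundary arcs. -/
theorem iUnion_coneMap_image_ae_eq (hS : IsCompact S) {r₀ : Plane} (hstar : StarConvex ℝ r₀ S) :
    (⋃ i, coneMap r₀ (B.arc i) '' (B.transversalTimes r₀ i ×ˢ Ioo (0 : ℝ) 1)) =ᵐ[volume] S := by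
  have hsub : (⋃ i, coneMap r₀ (B.arc i) '' (B.transversalTimes r₀ i ×ˢ Ioo (0 : ℝ) 1)) ⊆ S := by
    refine iUnion_subset fun i => ?_
    rintro _ ⟨p, hp, rfl⟩
    exact B.coneMap_mem hS.isClosed hstar i
      ⟨Ioo_subset_Icc_self hp.1.1, Ioo_subset_Icc_self hp.2⟩
  refine hsub.eventuallyLE.antisymm (ae_le_set.2 ?_)
  -- `E` collects the rays through arc end points and the boundary itself, `Z` the critical
  -- parameters; `s = 0` only gives the centre.
  let E : Set (ℝ × ℝ) := ({0, 1} : Set ℝ) ×ˢ univ ∪ Icc (0 : ℝ) 1 ×ˢ {1}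
  let Z (i : Fin B.n) : Set (ℝ × ℝ) :=
    {p ∈ Icc (0 : ℝ) 1 ×ˢ univ | cross (B.arc i p.1 - r₀) (B.velocity i p.1) = 0}
  have hEsub : E ⊆ Icc (0 : ℝ) 1 ×ˢ univ :=
    union_subset (prod_mono (by simp [insert_subset_iff]) subset_rfl)
      (prod_mono subset_rfl (subset_univ _))
  have hE : volume E = 0 := by
    refine measure_union_null ?_ ?_ <;>
    rw [Measure.volume_eq_prod, Measure.prod_prod] <;>
    simp [(toFinite ({0, 1} : Set ℝ)).measure_zero]
  have hder := fun i => fun t (ht : t ∈ Icc (0 : ℝ) 1) => B.hasDerivWithinAt_arc i ht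
  have hnull : volume ({r₀} ∪ ⋃ i, (coneMap r₀ (B.arc i) '' E ∪ coneMap r₀ (B.arc i) '' Z i)) = 0 :=
    measure_union_null (measure_singleton _) (measure_iUnion_null fun i => measure_union_null
      (volume_coneMap_image_of_null (hder i) hEsub hE)
      (volume_coneMap_image_of_cross_eq_zero (hder i) (fun p hp => hp.1) (fun p hp => hp.2)))
  refine measure_mono_null ?_ hnull
  rintro r ⟨hr, hrU⟩
  by_cases hne : r = r₀
  · exact Or.inl hne
  obtain ⟨i, p, hp, rfl⟩ := B.exists_coneMap_eq hS hr hne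
  refine Or.inr (mem_iUnion.2 ⟨i, ?_⟩)
  by_cases hpE : p ∈ E
  · exact Or.inl (mem_image_of_mem _ hpE)
  refine Or.inr (mem_image_of_mem _ ⟨⟨hp.1, mem_univ _⟩, ?_⟩)
  simp only [E, mem_union, mem_prod, mem_insert_iff, mem_singleton_iff, mem_univ, and_true,
    not_or, not_and] at hpE
  have ht : p.1 ∈ Ioo (0 : ℝ) 1 :=
    ⟨lt_of_le_of_ne hp.1.1 (Ne.symm hpE.1.1), lt_of_le_of_ne hp.1.2 hpE.1.2⟩
  by_contra hcross
  refine hrU (mem_iUnion.2 ⟨i, mem_image_of_mem _ ⟨⟨ht, ?_⟩, hp.2.1,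
    lt_of_le_of_ne hp.2.2 (hpE.2 hp.1)⟩⟩)
  exact lt_of_le_of_ne (B.cross_velocity_nonneg hS.isClosed hstar i ht) (Ne.symm hcross)

end PiecewiseSmoothBoundary

/-! ### Estimates for absolute convergence. -/

/-- A weakly singular kernel times a continuous density is bounded, on a compact set, by a power
of the distance that is integrable in the plane. -/
theorem IsWeaklySingular.exists_bound {K : Plane → ℝ} (hKsing : IsWeaklySingular K)
    (hK : ContinuousOn K {0}ᶜ) {S : Set Plane} (hS : IsCompact S) {ρ : Plane → ℝ}
    (hρ : ContinuousOn ρ S) (r₀ : Plane) :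
    ∃ β : ℝ, 1 ≤ β ∧ β < 2 ∧ ∃ C : ℝ,
      ∀ r ∈ S, r ≠ r₀ → |K (r - r₀) * ρ r| ≤ C * ‖r - r₀‖ ^ (-β) := by
  obtain ⟨α, hα, D, hD, hev⟩ := hKsing
  obtain ⟨δ, hδ, hball⟩ := Metric.eventually_nhds_iff.1 (eventually_nhdsWithin_iff.1 hev)
  obtain ⟨M, hM⟩ := hS.exists_bound_of_continuousOn hρ
  -- Radius at most 1 lets `α` be raised to `max α 1`; the exponent `1 - β` is then in `(-1, 0]`.
  set δ' := min δ 1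
  have hδ' : 0 < δ' := lt_min hδ one_pos
  set S' := S ∩ {r | δ' ≤ ‖r - r₀‖}
  have hS' : IsCompact S' :=
    hS.inter_right (isClosed_le continuous_const (by fun_prop))
  have hKc : ContinuousOn (fun r => K (r - r₀) * ‖r - r₀‖ ^ (max α 1)) S' := by
    have hne : ∀ r ∈ S', r - r₀ ≠ 0 := fun r hr => norm_pos_iff.1 (hδ'.trans_le hr.2)
    refine (hK.comp (by fun_prop) hne).mul ?_
    exact ContinuousOn.rpow_const (by fun_prop) fun r hr => Or.inl (norm_ne_zero_iff.2 (hne r hr))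
  obtain ⟨N, hN⟩ := hS'.exists_bound_of_continuousOn hKc
  refine ⟨max α 1, le_max_right _ _, max_lt hα (by norm_num), max D N * max M 0, fun r hr hne => ?_⟩
  have hpos : 0 < ‖r - r₀‖ := norm_pos_iff.2 (sub_ne_zero.2 hne)
  have hKb : |K (r - r₀)| ≤ max D N * ‖r - r₀‖ ^ (-max α 1) := by
    rcases lt_or_ge ‖r - r₀‖ δ' with hlt | hge
    · have h1 := hball (y := r - r₀) (by simpa using hlt.trans_le (min_le_left _ _))
        (sub_ne_zero.2 hne)
      refine h1.trans (mul_le_mul (le_max_left _ _) ?_ (by positivity) (by positivity))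
      exact Real.rpow_le_rpow_of_exponent_ge hpos (hlt.le.trans (min_le_right _ _))
        (neg_le_neg (le_max_left _ _))
    · have h1 := hN r ⟨hr, hge⟩
      rw [norm_mul, Real.norm_eq_abs, Real.norm_of_nonneg (by positivity)] at h1
      rw [Real.rpow_neg hpos.le, ← div_eq_mul_inv, le_div_iff₀ (by positivity)]
      exact h1.trans (le_max_right _ _)
  rw [abs_mul, mul_right_comm]
  exact mul_le_mul hKb ((hM r hr).trans (le_max_left _ _)) (abs_nonneg _) (by positivity)

theorem integrableOn_abs_sub_rpow {a : ℝ} (ha : -1 < a) (c : ℝ) :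
    IntegrableOn (fun t : ℝ => |t - c| ^ a) (Icc (c - 1) (c + 1)) := by
  have h1 : IntervalIntegrable (fun t : ℝ => |t| ^ a) volume 0 1 := by
    refine (intervalIntegral.intervalIntegrable_rpow' ha (a := 0) (b := 1)).congr fun t ht => ?_
    rw [uIoc_of_le zero_le_one] at ht
    simp [abs_of_pos ht.1]
  have h2 : IntervalIntegrable (fun t : ℝ => |t| ^ a) volume (-1) 0 := by
    rw [IntervalIntegrable.iff_comp_neg]
    simpa using h1.symm
  have h3 := (h2.trans h1).comp_sub_right c
  rwa [intervalIntegrable_iff_integrableOn_Icc_of_le (by linarith),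
    show -1 + c = c - 1 by ring, add_comm 1 c] at h3

namespace PiecewiseSmoothBoundary

variable {S : Set Plane} (B : PiecewiseSmoothBoundary S)

theorem integrableOn_norm_arc_rpow (r₀ : Plane) (i : Fin B.n) {a : ℝ} (ha : -1 < a)
    (ha0 : a ≤ 0) : IntegrableOn (fun t => ‖B.arc i t - r₀‖ ^ a) (Icc 0 1) := by
  refine LocallyIntegrableOn.integrableOn_isCompact (fun t₀ ht₀ => ?_) isCompact_Icc
  have hmeas : AEStronglyMeasurable (fun t => ‖B.arc i t - r₀‖ ^ a)
      (volume.restrict (Icc 0 1)) :=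
    (((((B.continuousOn_arc i).sub continuousOn_const).norm.aestronglyMeasurable
      measurableSet_Icc).aemeasurable).pow_const a).aestronglyMeasurable
  -- Off `r₀` the norm is bounded below and `|t - t₀| ≤ 1` suffices; at `r₀` the chord estimate
  -- applies.
  have hlow : ∃ m > 0, ∀ᶠ t in 𝓝[Icc 0 1] t₀, m * |t - t₀| ≤ ‖B.arc i t - r₀‖ := by
    by_cases h0 : B.arc i t₀ = r₀
    · obtain ⟨c, hc, hb⟩ := ((B.hasDerivWithinAt_arc i ht₀).isBigO_sub_chord
        (B.deriv_ne_zero i t₀ ht₀)).exists_pos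
      refine ⟨c⁻¹, by positivity, ?_⟩
      filter_upwards [hb.bound] with t ht
      rw [inv_mul_le_iff₀ hc, ← h0]
      exact ht
    · have hpos : 0 < ‖B.arc i t₀ - r₀‖ := norm_pos_iff.2 (sub_ne_zero.2 h0)
      refine ⟨‖B.arc i t₀ - r₀‖ / 2, by positivity, ?_⟩
      filter_upwards [((B.continuousOn_arc i t₀ ht₀).sub_const r₀).norm.eventually_const_lt
        (half_lt_self hpos), self_mem_nhdsWithin] with t ht htI
      have : |t - t₀| ≤ 1 := abs_le.2 ⟨by linarith [htI.1, ht₀.2], by linarith [htI.2, ht₀.1]⟩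
      refine le_trans ?_ ht.le
      exact mul_le_of_le_one_right (by positivity) this
  obtain ⟨m, hm, hev⟩ := hlow
  obtain ⟨U, hUo, hUt, hUb⟩ := mem_nhdsWithin.1 hev
  have hUm : MeasurableSet (U ∩ Icc (0 : ℝ) 1) := hUo.measurableSet.inter measurableSet_Icc
  refine ⟨U ∩ Icc 0 1, mem_nhdsWithin.2 ⟨U, hUo, hUt, subset_rfl⟩, ?_⟩
  have hdom : IntegrableOn (fun t => m ^ a * |t - t₀| ^ a) (U ∩ Icc 0 1) :=
    (((integrableOn_abs_sub_rpow ha t₀).mono_set (inter_subset_right.trans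
      (Icc_subset_Icc (by linarith [ht₀.2]) (by linarith [ht₀.1])))).const_mul _)
  refine hdom.mono' (hmeas.mono_measure (Measure.restrict_mono inter_subset_right le_rfl)) ?_
  filter_upwards [ae_restrict_mem hUm, ae_restrict_of_ae (Measure.ae_ne volume t₀)] with t ht hne
  have hpos : 0 < |t - t₀| := abs_pos.2 (sub_ne_zero.2 hne)
  rw [Real.norm_of_nonneg (by positivity), ← Real.mul_rpow hm.le hpos.le]
  exact Real.rpow_le_rpow_of_nonpos (by positivity) (hUb ht) ha0

end PiecewiseSmoothBoundary

/-- The radial integrals over segments from the centre converge absolutely. -/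
theorem intervalIntegrable_radial {K : Plane → ℝ} (hK : ContinuousOn K {0}ᶜ) {S : Set Plane}
    {ρ : Plane → ℝ} (hρ : ContinuousOn ρ S) {r₀ : Plane} (hstar : StarConvex ℝ r₀ S)
    {β C : ℝ} (hβ : β < 2)
    (hbound : ∀ r ∈ S, r ≠ r₀ → |K (r - r₀) * ρ r| ≤ C * ‖r - r₀‖ ^ (-β))
    {r : Plane} (hr : r ∈ S) :
    IntervalIntegrable (fun t : ℝ => t * K (t • (r - r₀)) * ρ (t • (r - r₀) + r₀))
      volume 0 1 := by
  by_cases hne : r = r₀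
  -- A boundary point may equal `r₀`; the integrand is then linear in `t`, with whatever value `K 0`
  -- has.
  · simp only [hne, sub_self, smul_zero, zero_add]
    exact (by fun_prop : Continuous fun t : ℝ => t * K 0 * ρ r₀).intervalIntegrable _ _
  have hmem : ∀ t ∈ Ioc (0 : ℝ) 1, t • (r - r₀) + r₀ ∈ S := fun t ht => by
    convert hstar hr (a := 1 - t) (b := t) (by linarith [ht.2]) ht.1.le (by ring) using 1
    module
  have hne' : ∀ t ∈ Ioc (0 : ℝ) 1, t • (r - r₀) ≠ 0 := fun t ht =>
    smul_ne_zero ht.1.ne' (sub_ne_zero.2 hne)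
  rw [intervalIntegrable_iff_integrableOn_Ioc_of_le zero_le_one]
  have hdom : IntegrableOn (fun t : ℝ => C * ‖r - r₀‖ ^ (-β) * t ^ (1 - β)) (Ioc 0 1) :=
    ((intervalIntegrable_iff_integrableOn_Ioc_of_le zero_le_one).1
      (intervalIntegral.intervalIntegrable_rpow' (by linarith))).const_mul _
  refine hdom.mono' (ContinuousOn.aestronglyMeasurable ?_ measurableSet_Ioc) ?_
  · exact (continuousOn_id.mul (hK.comp (by fun_prop) hne')).mul (hρ.comp (by fun_prop) hmem)
  filter_upwards [ae_restrict_mem measurableSet_Ioc] with t ht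
  have h1 := hbound _ (hmem t ht) (by simpa using hne' t ht)
  rw [add_sub_cancel_right, norm_smul, Real.norm_of_nonneg ht.1.le,
    Real.mul_rpow ht.1.le (norm_nonneg _)] at h1
  rw [mul_assoc, norm_mul, Real.norm_of_nonneg ht.1.le, Real.norm_eq_abs, sub_eq_add_neg 1 β,
    Real.rpow_add ht.1, Real.rpow_one]
  nlinarith [mul_le_mul_of_nonneg_left h1 ht.1.le]

namespace PiecewiseSmoothBoundary

variable {S : Set Plane} (B : PiecewiseSmoothBoundary S)

/-- The integrand of the boundary integral in terms of the velocity. -/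
theorem integrand_mul_cross (F : Plane → ℝ) (r₀ : Plane) (i : Fin B.n) {t : ℝ}
    (ht : t ∈ Icc (0 : ℝ) 1) :
    B.integrand (fun r τ => F r * cross (r - r₀) τ) i t =
      F (B.arc i t) * cross (B.arc i t - r₀) (B.velocity i t) := by
  have hv : ‖B.velocity i t‖ ≠ 0 := norm_ne_zero_iff.2 (B.deriv_ne_zero i t ht)
  simp only [integrand, unitTangent, cross_smul_right]
  field_simp

/-- Absolute convergence, in the parameters `(t, s)`, of the integral over the open cone. -/
theorem integrableOn_cone {K : Plane → ℝ} (hK : ContinuousOn K {0}ᶜ) (hS : IsCompact S)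
    {ρ : Plane → ℝ} (hρ : ContinuousOn ρ S) {r₀ : Plane} (hstar : StarConvex ℝ r₀ S)
    {β C : ℝ} (hβ1 : 1 ≤ β) (hβ : β < 2)
    (hbound : ∀ r ∈ S, r ≠ r₀ → |K (r - r₀) * ρ r| ≤ C * ‖r - r₀‖ ^ (-β)) (i : Fin B.n) :
    IntegrableOn (fun p : ℝ × ℝ => p.2 * cross (B.arc i p.1 - r₀) (B.velocity i p.1) *
        (K (coneMap r₀ (B.arc i) p - r₀) * ρ (coneMap r₀ (B.arc i) p)))
      (B.transversalTimes r₀ i ×ˢ Ioo (0 : ℝ) 1) := by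
  set A := B.transversalTimes r₀ i ×ˢ Ioo (0 : ℝ) 1
  have hAm : MeasurableSet A := (B.measurableSet_transversalTimes r₀ i).prod measurableSet_Ioo
  have hfst : MapsTo Prod.fst A (Icc (0 : ℝ) 1) := fun p hp => Ioo_subset_Icc_self hp.1.1
  have hx : ∀ p ∈ A, B.arc i p.1 - r₀ ≠ 0 := fun p hp h0 => by
    have := hp.1.2
    simp [h0, cross] at this
  have hmem : ∀ p ∈ A, coneMap r₀ (B.arc i) p ∈ S := fun p hp =>
    B.coneMap_mem hS.isClosed hstar i ⟨hfst hp, Ioo_subset_Icc_self hp.2⟩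
  have hne : ∀ p ∈ A, coneMap r₀ (B.arc i) p - r₀ ≠ 0 := fun p hp => by
    simpa [coneMap] using ⟨hp.2.1.ne', hx p hp⟩
  obtain ⟨M, hM⟩ := isCompact_Icc.exists_bound_of_continuousOn (B.continuousOn_velocity i)
  have harc : ContinuousOn (fun p : ℝ × ℝ => B.arc i p.1) A :=
    (B.continuousOn_arc i).comp continuousOn_fst hfst
  have hcone : ContinuousOn (coneMap r₀ (B.arc i)) A :=
    (continuousOn_snd.smul (harc.sub continuousOn_const)).add continuousOn_const
  -- The Jacobian is at most `s |γ - r₀| M`, so the majorant is a product of functions of `t` and of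
  -- `s`.
  have hdom : IntegrableOn (fun p : ℝ × ℝ =>
      (M * C * ‖B.arc i p.1 - r₀‖ ^ (1 - β)) * p.2 ^ (1 - β)) A := by
    rw [IntegrableOn, Measure.volume_eq_prod, ← Measure.prod_restrict]
    refine Integrable.mul_prod (f := fun t => M * C * ‖B.arc i t - r₀‖ ^ (1 - β))
      (g := fun s : ℝ => s ^ (1 - β)) ?_ ?_
    · exact ((B.integrableOn_norm_arc_rpow r₀ i (by linarith) (by linarith)).mono_set
        fun t ht => Ioo_subset_Icc_self ht.1).const_mul _
    · exact (intervalIntegral.integrableOn_Ioo_rpow_iff zero_lt_one).2 (by linarith)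
  refine hdom.mono' (ContinuousOn.aestronglyMeasurable ?_ hAm) ?_
  · refine (continuousOn_snd.mul
      ((B.continuousOn_cross_velocity r₀ i).comp continuousOn_fst hfst)).mul ?_
    exact (hK.comp (hcone.sub continuousOn_const) hne).mul (hρ.comp hcone hmem)
  filter_upwards [ae_restrict_mem hAm] with p hp
  have hs : 0 < p.2 := hp.2.1
  have hxp : 0 < ‖B.arc i p.1 - r₀‖ := norm_pos_iff.2 (hx p hp)
  have h1 := hbound _ (hmem p hp) (sub_ne_zero.1 (hne p hp))
  have hnorm : ‖coneMap r₀ (B.arc i) p - r₀‖ = p.2 * ‖B.arc i p.1 - r₀‖ := by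
    rw [coneMap, add_sub_cancel_right, norm_smul, Real.norm_of_nonneg hs.le]
  rw [hnorm, Real.mul_rpow hs.le hxp.le] at h1
  have h2 : |cross (B.arc i p.1 - r₀) (B.velocity i p.1)| ≤ ‖B.arc i p.1 - r₀‖ * M :=
    (abs_cross_le _ _).trans (by gcongr; exact hM _ (hfst hp))
  rw [norm_mul, norm_mul, Real.norm_of_nonneg hs.le, Real.norm_eq_abs, Real.norm_eq_abs]
  calc _ ≤ p.2 * (‖B.arc i p.1 - r₀‖ * M) *
        (C * (p.2 ^ (-β) * ‖B.arc i p.1 - r₀‖ ^ (-β))) := by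
        have := (abs_nonneg _).trans h2
        gcongr
    _ = _ := by
      rw [sub_eq_add_neg 1 β, Real.rpow_add hs, Real.rpow_add hxp, Real.rpow_one, Real.rpow_one]
      ring

end PiecewiseSmoothBoundary

/-! ### Assembly of the formula. -/

theorem mainTheorem1
    (K : Plane → ℝ) (hKsing : IsWeaklySingular K) (hK : ContDiffOn ℝ 1 K {0}ᶜ)
    (S : Set Plane) (hS : IsCompact S) (B : PiecewiseSmoothBoundary S)
    (ρ : Plane → ℝ) (hρ : ContDiffOn ℝ 1 ρ S)
    (r₀ : Plane) (hr₀ : r₀ ∈ S) (hstar : StarConvex ℝ r₀ S) :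
    IntegrableOn (fun r => K (r - r₀) * ρ r) S volume ∧
    (∀ r ∈ frontier S, IntervalIntegrable
      (fun t : ℝ => t * K (t • (r - r₀)) * ρ (t • (r - r₀) + r₀)) volume 0 1) ∧
    B.BoundaryIntegrable (fun r τ =>
      (∫ t in (0 : ℝ)..1, t * K (t • (r - r₀)) * ρ (t • (r - r₀) + r₀)) * cross (r - r₀) τ) ∧
    ∫ r in S, K (r - r₀) * ρ r =
      B.boundaryIntegral (fun r τ =>
        (∫ t in (0 : ℝ)..1, t * K (t • (r - r₀)) * ρ (t • (r - r₀) + r₀)) *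
          cross (r - r₀) τ) := by
  obtain ⟨β, hβ1, hβ, C, hbound⟩ := hKsing.exists_bound hK.continuousOn hS hρ.continuousOn r₀
  set F : Plane → ℝ := fun r =>
    ∫ t in (0 : ℝ)..1, t * K (t • (r - r₀)) * ρ (t • (r - r₀) + r₀) with hF
  set T := B.transversalTimes r₀
  set A : Fin B.n → Set (ℝ × ℝ) := fun i => T i ×ˢ Ioo (0 : ℝ) 1 with hAdef
  set G : Fin B.n → ℝ × ℝ → ℝ := fun i p =>
    p.2 * cross (B.arc i p.1 - r₀) (B.velocity i p.1) *
      (K (coneMap r₀ (B.arc i) p - r₀) * ρ (coneMap r₀ (B.arc i) p)) with hG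
  have hGint : ∀ i, IntegrableOn (G i) (A i) :=
    B.integrableOn_cone hK.continuousOn hS hρ.continuousOn hstar hβ1 hβ hbound
  have hTm : ∀ i, MeasurableSet (T i) := B.measurableSet_transversalTimes r₀
  have hAm : ∀ i, MeasurableSet (A i) := fun i => (hTm i).prod measurableSet_Ioo
  have hAsub : ∀ i, A i ⊆ Icc (0 : ℝ) 1 ×ˢ univ := B.transversalTimes_prod_subset r₀
  have hder := fun i => fun t (ht : t ∈ Icc (0 : ℝ) 1) => B.hasDerivWithinAt_arc i ht
  have hinj : ∀ i, InjOn (coneMap r₀ (B.arc i)) (A i) := fun i p hp q hq h =>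
    (B.eq_of_coneMap_eq hS.isClosed hstar hp hq h).2
  have habs : ∀ i, ∀ p ∈ A i, |p.2 * cross (B.arc i p.1 - r₀) (B.velocity i p.1)| *
      (K (coneMap r₀ (B.arc i) p - r₀) * ρ (coneMap r₀ (B.arc i) p)) = G i p :=
    fun i p hp => by rw [abs_of_pos (mul_pos hp.2.1 hp.1.2)]
  have himg : ∀ i, IntegrableOn (fun r => K (r - r₀) * ρ r) (coneMap r₀ (B.arc i) '' A i) :=
    fun i => (integrableOn_coneMap_image_iff (hder i) (hAsub i) (hAm i) (hinj i) _).2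
      ((integrableOn_congr_fun (habs i) (hAm i)).2 (hGint i))
  have hae := B.iUnion_coneMap_image_ae_eq hS hstar
  have hinner : ∀ i t, ∫ s in Ioo (0 : ℝ) 1, G i (t, s) =
      F (B.arc i t) * cross (B.arc i t - r₀) (B.velocity i t) := by
    intro i t
    rw [hF]
    simp only
    rw [← intervalIntegral.integral_mul_const, intervalIntegral.integral_of_le zero_le_one,
      integral_Ioc_eq_integral_Ioo]
    congr 1
    ext s
    simp only [hG, coneMap, add_sub_cancel_right]
    ring
  -- Non-transversal times contribute nothing, so integrals over `T i` extend to the whole arc.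
  have hzero : ∀ i, ∀ t ∈ Ioo (0 : ℝ) 1 \ T i,
      F (B.arc i t) * cross (B.arc i t - r₀) (B.velocity i t) = 0 := by
    intro i t ht
    have h0 : cross (B.arc i t - r₀) (B.velocity i t) = 0 :=
      le_antisymm (not_lt.1 fun h => ht.2 ⟨ht.1, h⟩)
        (B.cross_velocity_nonneg hS.isClosed hstar i ht.1)
    rw [h0, mul_zero]
  have hTsub : ∀ i, T i ⊆ Ioo (0 : ℝ) 1 := fun i t ht => ht.1
  have hintegrand : ∀ i, EqOn (B.integrand (fun r τ => F r * cross (r - r₀) τ) i)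
      (fun t => F (B.arc i t) * cross (B.arc i t - r₀) (B.velocity i t)) (Ioo 0 1) :=
    fun i t ht => B.integrand_mul_cross F r₀ i (Ioo_subset_Icc_self ht)
  have hprod : ∀ i, Integrable (G i) ((volume.restrict (T i)).prod (volume.restrict (Ioo 0 1))) :=
    fun i => by
      rw [Measure.prod_restrict]
      exact hGint i
  refine ⟨?_, ?_, ?_, ?_⟩
  · exact (integrableOn_finite_iUnion.2 himg).congr_set_ae hae.symm
  · exact fun r hr => intervalIntegrable_radial hK.continuousOn hρ.continuousOn hstar hβ hbound
      (hS.isClosed.frontier_subset hr)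
  · intro i
    rw [intervalIntegrable_iff_integrableOn_Ioo_of_le zero_le_one,
      integrableOn_congr_fun (hintegrand i) measurableSet_Ioo]
    have h1 := (hprod i).integral_prod_left
    simp only [hinner] at h1
    exact IntegrableOn.of_forall_sdiff_eq_zero h1 measurableSet_Ioo (hzero i)
  · have hdisj : Pairwise (Function.onFun Disjoint fun i => coneMap r₀ (B.arc i) '' A i) := by
      intro i j hij
      rw [Function.onFun, Set.disjoint_left]
      rintro _ ⟨p, hp, rfl⟩ ⟨q, hq, hpq⟩
      exact hij (B.eq_of_coneMap_eq hS.isClosed hstar hp hq hpq.symm).1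
    rw [← setIntegral_congr_set hae, integral_iUnion_fintype
      (fun i => measurableSet_coneMap_image (hder i) (hAsub i) (hAm i) (hinj i)) hdisj himg,
      PiecewiseSmoothBoundary.boundaryIntegral]
    refine Finset.sum_congr rfl fun i _ => ?_
    rw [setIntegral_coneMap_image (hder i) (hAsub i) (hAm i) (hinj i),
      setIntegral_congr_fun (hAm i) (habs i), Measure.volume_eq_prod,
      setIntegral_prod _ (hGint i), intervalIntegral.integral_of_le zero_le_one,
      integral_Ioc_eq_integral_Ioo, setIntegral_congr_fun measurableSet_Ioo (hintegrand i)]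
    simp only [hinner]
    exact (setIntegral_eq_of_subset_of_forall_sdiff_eq_zero measurableSet_Ioo (hTsub i)
      (hzero i)).symm
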